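/- Let $\phi:[0,\infty)\to(0,\infty)$ be continuous with $\phi\in L^2(0,\infty)$ and $\phi\in\mathcal W$. Here $\mathcal W=W^{1,2}_{\mathrm{loc}}[0,\infty)$ is the space of continuous functions $f$ on $[0,\infty)$ for which there is a function $f'$ (the weak derivative), square integrable on every interval $[0,a]$, with $f(x)=f(0)+\int_0^x f'(s)\,ds$ for all $x\ge 0$. All function spaces other than for $\phi$ itself are complex. Put $\psi(x)=\phi(x)\int_0^x\phi(s)^{-2}\,ds$ and $$G(x,y)=\begin{cases}\psi(x)\phi(y),&0\le x\le y,\\ \phi(x)\psi(y),&0\le y\le x,\end{cases}$$ and assume that $G(\cdot,\cdot)$ is the integral kernel of a bounded operator on $L^2(0,\infty)$. Let $\gamma\in\mathbb C\setminus\{0\}$, put $\xi=\psi+\gamma\phi$ and $$G_\gamma(x,y)=\begin{cases}\xi(x)\phi(y),&0\le x\le y,\\ \phi(x)\xi(y),&0\le y\le x.\end{cases}$$ Then $G_\gamma(\cdot,\cdot)$ is the integral kernel of an injective bounded operator $G_\gamma$ on $L^2(0,\infty)$. Put $H_\gamma=G_\gamma^{-1}$, with domain $\mathrm{Ran}(G_\gamma)$.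 Let $\mathcal D_\gamma$ be the space of all $g$ such that 1. $g\in L^2(0,\infty)\cap\mathcal W$; 2. $\phi g'-\phi'g\in\mathcal W$ (that is, it agrees almost everywhere with an element of $\mathcal W$, with which it is identified); 3. $(\phi g'-\phi'g)(0)=\dfrac{g(0)}{\gamma\,\phi(0)}$; 4. $\phi^{-1}(\phi g'-\phi'g)'\in L^2(0,\infty)$; 5. $\lim_{x\to\infty}g(x)/\psi(x)=0$. Then $\mathrm{Dom}(H_\gamma)=\mathrm{Ran}(G_\gamma)=\mathcal D_\gamma$. For every $g\in\mathcal D_\gamma$, $$H_\gamma g=\phi^{-1}(\phi'g-\phi g')'.$$ For all $g_1,g_2\in\mathcal D_\gamma$, with $\langle f,h\rangle=\int_0^\infty f\,\overline h\,dx$, $$\langle H_\gamma g_1,g_2\rangle=\int_0^\infty(\phi g_1'-\phi'g_1)(\phi\overline{g_2'}-\phi'\overline{g_2})\phi^{-2}\,dx+\frac{g_1(0)\overline{g_2(0)}}{\gamma\,\phi(0)^2},$$ where the integral converges absolutely. -/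

import Mathlib

open MeasureTheory Set Filter Topology

noncomputable section

namespace RobinSchrodinger

/-- Lebesgue measure on the half-line `(0,∞)`. -/
abbrev halfLine : Measure ℝ := volume.restrict (Ioi (0 : ℝ))

/-- The complex Hilbert space `L²(0,∞)`. -/
abbrev L2 : Type := Lp ℂ 2 halfLine

/-- `f` belongs to `W^{1,2}_loc[0,∞)` and `f'` is (a representative of) its weak derivative:
`f` is continuous on `[0,∞)`, `f'` is square integrable on every bounded interval `(0,a]`, and
`f x = f 0 + ∫₀ˣ f'` for all `x ≥ 0`. Values at negative arguments play no role. -/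
structure HasWeakDeriv {E : Type*} [NormedAddCommGroup E] [NormedSpace ℝ E]
    (f f' : ℝ → E) : Prop where
  continuousOn : ContinuousOn f (Ici 0)
  locL2 : ∀ a : ℝ, 0 < a → MemLp f' 2 (volume.restrict (Ioc 0 a))
  eq_integral : ∀ x : ℝ, 0 ≤ x → f x = f 0 + ∫ s in (0 : ℝ)..x, f' s

/-- The second solution `ψ(x) = φ(x) ∫₀ˣ φ(s)⁻² ds`. -/
def psi (φ : ℝ → ℝ) (x : ℝ) : ℝ := φ x * ∫ s in (0 : ℝ)..x, (φ s ^ 2)⁻¹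

/-- `ξ = ψ + γ φ`. -/
def xi (φ : ℝ → ℝ) (γ : ℂ) (x : ℝ) : ℂ := (psi φ x : ℂ) + γ * (φ x : ℂ)

/-- The Green function built from `φ` and a second solution `η`:
`η(x) φ(y)` for `x ≤ y` and `φ(x) η(y)` for `y ≤ x`. -/
def greenKernel (φ : ℝ → ℝ) (η : ℝ → ℂ) (x y : ℝ) : ℂ :=
  if x ≤ y then η x * (φ y : ℂ) else (φ x : ℂ) * η y

/-- The Green function `G(x,y)` for the Dirichlet condition at `0`. -/
def dirichletGreen (φ : ℝ → ℝ) : ℝ → ℝ → ℂ := greenKernel φ (fun x => (psi φ x : ℂ))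

/-- The Green function `G_γ(x,y)`. -/
def robinGreen (φ : ℝ → ℝ) (γ : ℂ) : ℝ → ℝ → ℂ := greenKernel φ (xi φ γ)

/-- `K` is the integral kernel of the bounded operator `T` on `L²(0,∞)`. -/
def IsKernelOf (K : ℝ → ℝ → ℂ) (T : L2 →L[ℂ] L2) : Prop :=
  ∀ f : L2, ∀ᵐ x ∂halfLine,
    Integrable (fun y => K x y * f y) halfLine ∧ T f x = ∫ y, K x y * f y ∂halfLine

/-- The (in general unbounded) inverse `T⁻¹`, with domain `Ran T`, of an injective bounded
operator `T` on `L²(0,∞)`. -/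
def inverseOp (T : L2 →L[ℂ] L2) : L2 →ₗ.[ℂ] L2 :=
  ((T : L2 →ₗ[ℂ] L2).toPMap ⊤).inverse

/-- `g` satisfies the conditions that define the space `𝒟_γ`. Here `φ'` and `g'` are the weak
derivatives of `φ` and `g`, `w` is the continuous version of `φ g' - φ' g`, and `w'` is the weak
derivative of `w`. -/
structure RobinConditions (φ φ' : ℝ → ℝ) (γ : ℂ) (g g' w w' : ℝ → ℂ) : Prop where
  memL2 : MemLp g 2 halfLine
  weakDeriv : HasWeakDeriv g g'
  boundary : w 0 = g 0 / (γ * (φ 0 : ℂ))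
  quasi_eq : w =ᵐ[halfLine] fun x => (φ x : ℂ) * g' x - (φ' x : ℂ) * g x
  quasi_weakDeriv : HasWeakDeriv w w'
  image_memL2 : MemLp (fun x => (φ x : ℂ)⁻¹ * w' x) 2 halfLine
  decay : Tendsto (fun x => g x / (psi φ x : ℂ)) atTop (𝓝 0)

/-- The space `𝒟_γ`, as a set of elements of `L²(0,∞)`. -/
def robinDomain (φ φ' : ℝ → ℝ) (γ : ℂ) : Set L2 :=
  {u | ∃ g g' w w' : ℝ → ℂ, u =ᵐ[halfLine] g ∧ RobinConditions φ φ' γ g g' w w'}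

end RobinSchrodinger

end

noncomputable section

namespace RobinSchrodinger

/-! ### Absolutely continuous functions -/

/-! Write `Q = ∫₀ˣ φ⁻²`, so that `ψ = φ Q`, and for `f` in `L²` put `A(s) = ∫ₛ^∞ φ f`. The Dirichlet
kernel is `φ(x) Q(min x y) φ(y)`, and Fubini turns its action into `G f = φ ∫₀ˣ φ⁻² A`
(`integral_green`). The Robin kernel differs from it by the rank-one kernel `γ φ(x) φ(y)`, which is
bounded because `φ ∈ L²`. Hence `g = G_γ f` is equivalent to `g / φ = γ A(0) + ∫₀ˣ φ⁻² A`.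

Differentiating, `φ g' - φ' g = φ² (g/φ)' = A` and `A' = -φ f`. This gives the formula for `H_γ`,
and the value at `0` gives the boundary condition. The quotient `g / ψ` is, up to `γ A(0) / Q`, an
average of `A` with weight `φ⁻²`. Since `Q → ∞`, it has the same limit as `A`, namely `0`
(`tendsto_div_invSqPrimitive`).

Conversely, for `g` in the domain put `f = -φ⁻¹ w'`. Then `w` is `A` plus a constant; the decay
condition makes that constant zero, and the boundary condition fixes `g(0)`, so `g = G_γ f`
(`RobinConditions.eq_robinQuotient`).

For the form, a second use of Fubini gives `∫ φ⁻² A₁ conj A₂ = ⟨f₁, G f₂⟩`, absolutely convergent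
because `G` is bounded (`integral_green_form`). The rank-one term of `G_γ` supplies the boundary
term. -/

theorem absolutelyContinuousOnInterval_of_dist_le {X Y : Type*} [PseudoMetricSpace X]
    [PseudoMetricSpace Y] {f : ℝ → X} {g : ℝ → Y} {a b C : ℝ}
    (hf : AbsolutelyContinuousOnInterval f a b)
    (h : ∀ s ∈ uIcc a b, ∀ t ∈ uIcc a b, dist (g s) (g t) ≤ C * dist (f s) (f t)) :
    AbsolutelyContinuousOnInterval g a b := by
  unfold AbsolutelyContinuousOnInterval at hf ⊢
  apply squeeze_zero' ?_ ?_ (by simpa using hf.const_mul C)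
  · exact Eventually.of_forall fun _ ↦ Finset.sum_nonneg fun i _ ↦ dist_nonneg
  rw [eventually_inf_principal]
  filter_upwards with E hE
  rw [Finset.mul_sum]
  exact Finset.sum_le_sum fun i hi ↦ h _ (hE.1 i hi).1 _ (hE.1 i hi).2

/-- The real and imaginary parts of the primitive are primitives of real integrable functions; they
are recombined with the constants `1` and `I`. -/
theorem absolutelyContinuousOnInterval_add_integral {u : ℝ → ℂ} {a : ℝ} (c : ℂ)
    (hu : IntervalIntegrable u volume 0 a) :
    AbsolutelyContinuousOnInterval (fun x ↦ c + ∫ s in (0 : ℝ)..x, u s) 0 a := by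
  have hre : IntervalIntegrable (fun s ↦ (u s).re) volume 0 a := ⟨hu.1.re, hu.2.re⟩
  have him : IntervalIntegrable (fun s ↦ (u s).im) volume 0 a := ⟨hu.1.im, hu.2.im⟩
  have hc (z : ℂ) : AbsolutelyContinuousOnInterval (fun _ : ℝ ↦ z) 0 a :=
    (LipschitzWith.const z).lipschitzOnWith.absolutelyContinuousOnInterval
  have hsum := (hc c).add
    (((hre.absolutelyContinuousOnInterval_intervalIntegral (c := 0) (by simp)).smul (hc 1)).add
    ((him.absolutelyContinuousOnInterval_intervalIntegral (c := 0) (by simp)).smul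
      (hc Complex.I)))
  refine absolutelyContinuousOnInterval_of_dist_le (C := 1) hsum fun s hs t ht ↦ ?_
  have key : ∀ s ∈ uIcc 0 a, (∫ v in (0 : ℝ)..s, u v) =
      (∫ v in (0 : ℝ)..s, (u v).re) • (1 : ℂ) + (∫ v in (0 : ℝ)..s, (u v).im) • Complex.I := by
    intro s hs
    have hus : IntervalIntegrable u volume 0 s :=
      hu.mono_set (uIcc_subset_uIcc left_mem_uIcc hs)
    have h1 := Complex.reCLM.intervalIntegral_comp_comm hus
    have h2 := Complex.imCLM.intervalIntegral_comp_comm hus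
    simp only [Complex.reCLM_apply, Complex.imCLM_apply] at h1 h2
    rw [h1, h2]
    apply Complex.ext <;> simp
  simp only [one_mul, Pi.add_apply, Pi.smul_apply', key s hs, key t ht, le_refl]

/-- `F` minus the primitive of `d` is absolutely continuous with derivative zero almost everywhere,
hence constant. -/
theorem eq_add_integral_of_ae_hasDerivAt {F d : ℝ → ℂ} {a : ℝ}
    (hF : AbsolutelyContinuousOnInterval F 0 a) (hd : IntervalIntegrable d volume 0 a)
    (h : ∀ᵐ x, x ∈ uIcc 0 a → HasDerivAt F (d x) x) :
    F a = F 0 + ∫ s in (0 : ℝ)..a, d s := by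
  have hac := hF.sub (absolutelyContinuousOnInterval_add_integral 0 hd)
  obtain ⟨C, hC⟩ := hac.const_of_ae_hasDerivAt_zero (by
    filter_upwards [h, hd.ae_hasDerivAt_integral] with x h1 h2 hx
    have := (h1 hx).sub ((h2 hx 0 (by simp)).const_add 0)
    rwa [sub_self] at this)
  have h0 := hC 0 (by simp)
  have h1 := hC a (by simp)
  simp only [Pi.sub_apply, zero_add, intervalIntegral.integral_same, sub_zero] at h0 h1
  rw [h0, ← h1]; ring

/-! ### Calculus of weak derivatives -/

theorem ae_halfLine_of_forall_nat {p : ℝ → Prop}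
    (h : ∀ n : ℕ, ∀ᵐ x, x ∈ uIcc (0 : ℝ) n → p x) : ∀ᵐ x ∂halfLine, p x := by
  rw [ae_restrict_iff' measurableSet_Ioi]
  filter_upwards [ae_all_iff.2 h] with x hx hx0
  obtain ⟨n, hn⟩ := exists_nat_ge x
  exact hx n (by rw [uIcc_of_le (by positivity)]; exact ⟨le_of_lt hx0, hn⟩)

theorem HasWeakDeriv.intervalIntegrable {E : Type*} [NormedAddCommGroup E] [NormedSpace ℝ E]
    {f f' : ℝ → E} (h : HasWeakDeriv f f') {a : ℝ}
    (ha : 0 ≤ a) : IntervalIntegrable f' volume 0 a := by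
  rcases ha.eq_or_lt with rfl | ha'
  · simp
  rw [intervalIntegrable_iff_integrableOn_Ioc_of_le ha]
  exact (h.locL2 a ha').integrable (by norm_num)

theorem HasWeakDeriv.ae_hasDerivAt {f f' : ℝ → ℂ} (h : HasWeakDeriv f f') :
    ∀ᵐ x ∂halfLine, HasDerivAt f (f' x) x := by
  have : ∀ᵐ x ∂halfLine, HasDerivAt (fun x ↦ ∫ s in (0 : ℝ)..x, f' s) (f' x) x := by
    refine ae_halfLine_of_forall_nat fun n ↦ ?_
    filter_upwards [(h.intervalIntegrable n.cast_nonneg).ae_hasDerivAt_integral] with x hx hxn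
    exact hx hxn 0 (by simp)
  filter_upwards [this, ae_restrict_mem measurableSet_Ioi] with x hx hx0
  refine (hx.const_add (f 0)).congr_of_eventuallyEq ?_
  filter_upwards [Ioi_mem_nhds hx0] with y hy using h.eq_integral y (le_of_lt hy)

theorem HasWeakDeriv.absolutelyContinuous {f f' : ℝ → ℂ} (h : HasWeakDeriv f f') {a : ℝ}
    (ha : 0 ≤ a) : AbsolutelyContinuousOnInterval f 0 a := by
  refine absolutelyContinuousOnInterval_of_dist_le (C := 1)
    (absolutelyContinuousOnInterval_add_integral (f 0) (h.intervalIntegrable ha))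
    fun s hs t ht ↦ ?_
  rw [uIcc_of_le ha] at hs ht
  rw [one_mul, h.eq_integral s hs.1, h.eq_integral t ht.1]

/-- This criterion reduces the product and inverse rules for weak derivatives to the pointwise rules
almost everywhere. -/
theorem hasWeakDeriv_of_ae_hasDerivAt {f f' : ℝ → ℂ}
    (hc : ∀ a, 0 ≤ a → AbsolutelyContinuousOnInterval f 0 a)
    (hL : ∀ a : ℝ, 0 < a → MemLp f' 2 (volume.restrict (Ioc 0 a)))
    (hd : ∀ᵐ x ∂halfLine, HasDerivAt f (f' x) x) : HasWeakDeriv f f' where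
  continuousOn := by
    intro x hx
    have hx' : (0 : ℝ) ≤ x := hx
    have h := (hc (x + 1) (by linarith)).continuousOn x
      (by rw [uIcc_of_le (by linarith)]; exact ⟨hx', by linarith⟩)
    rw [uIcc_of_le (by linarith)] at h
    exact h.mono_of_mem_nhdsWithin (by
      filter_upwards [self_mem_nhdsWithin, mem_nhdsWithin_of_mem_nhds
        (Iio_mem_nhds (show x < x + 1 by linarith))] with y h1 h2 using ⟨h1, le_of_lt h2⟩)
  locL2 := hL
  eq_integral := by
    intro x hx
    rcases hx.eq_or_lt with rfl | hx'
    · simp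
    refine eq_add_integral_of_ae_hasDerivAt (hc x hx) ?_ ?_
    · rw [intervalIntegrable_iff_integrableOn_Ioc_of_le hx]
      exact (hL x hx').integrable (by norm_num)
    · rw [ae_restrict_iff' measurableSet_Ioi] at hd
      filter_upwards [hd, Measure.ae_ne volume 0] with y hy hy0 hyx
      rw [uIcc_of_le hx] at hyx
      exact hy (lt_of_le_of_ne hyx.1 (Ne.symm hy0))

theorem HasWeakDeriv.unique {f f' g g' : ℝ → ℂ} (hf : HasWeakDeriv f f') (hg : HasWeakDeriv g g')
    (h : ∀ x, 0 < x → f x = g x) : f' =ᵐ[halfLine] g' := by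
  filter_upwards [hf.ae_hasDerivAt, hg.ae_hasDerivAt, ae_restrict_mem measurableSet_Ioi]
    with x h1 h2 hx
  refine h1.unique (h2.congr_of_eventuallyEq ?_)
  filter_upwards [Ioi_mem_nhds hx] with y hy using h y hy

theorem memLp_Ioc_mul_of_continuousOn {f g : ℝ → ℂ} (hg : ContinuousOn g (Ici 0)) {a : ℝ}
    (hf : MemLp f 2 (volume.restrict (Ioc 0 a))) :
    MemLp (fun x ↦ f x * g x) 2 (volume.restrict (Ioc 0 a)) := by
  obtain ⟨C, hC⟩ := isCompact_Icc.exists_bound_of_continuousOn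
    (hg.mono fun x (hx : x ∈ Icc 0 a) ↦ hx.1)
  have hgm : AEStronglyMeasurable g (volume.restrict (Ioc 0 a)) :=
    (hg.mono fun x hx ↦ le_of_lt hx.1).aestronglyMeasurable measurableSet_Ioc
  refine hf.of_le_mul (c := C) (hf.1.mul hgm) ?_
  filter_upwards [ae_restrict_mem measurableSet_Ioc] with x hx
  rw [norm_mul, mul_comm]
  exact mul_le_mul_of_nonneg_right (hC x ⟨le_of_lt hx.1, hx.2⟩) (norm_nonneg _)

theorem HasWeakDeriv.mul {f f' g g' : ℝ → ℂ} (hf : HasWeakDeriv f f') (hg : HasWeakDeriv g g') :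
    HasWeakDeriv (fun x ↦ f x * g x) (fun x ↦ f' x * g x + g' x * f x) := by
  refine hasWeakDeriv_of_ae_hasDerivAt
    (fun a ha ↦ (hf.absolutelyContinuous ha).smul (hg.absolutelyContinuous ha))
    (fun a ha ↦ (memLp_Ioc_mul_of_continuousOn hg.continuousOn (hf.locL2 a ha)).add
      (memLp_Ioc_mul_of_continuousOn hf.continuousOn (hg.locL2 a ha))) ?_
  filter_upwards [hf.ae_hasDerivAt, hg.ae_hasDerivAt] with x h1 h2
  convert! h1.mul h2 using 1
  ring

theorem HasWeakDeriv.inv {f f' : ℝ → ℂ} (hf : HasWeakDeriv f f') (h0 : ∀ x, 0 ≤ x → f x ≠ 0) :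
    HasWeakDeriv (fun x ↦ (f x)⁻¹) (fun x ↦ f' x * -((f x) ^ 2)⁻¹) := by
  have hci : ContinuousOn (fun x ↦ (f x)⁻¹) (Ici 0) := hf.continuousOn.inv₀ h0
  refine hasWeakDeriv_of_ae_hasDerivAt (fun a ha ↦ ?_)
    (fun a ha ↦ memLp_Ioc_mul_of_continuousOn
      ((hf.continuousOn.pow 2).inv₀ fun x hx ↦ pow_ne_zero 2 (h0 x hx)).neg (hf.locL2 a ha)) ?_
  · obtain ⟨C, hC⟩ := isCompact_Icc.exists_bound_of_continuousOn
      (hci.mono fun x (hx : x ∈ Icc 0 a) ↦ hx.1)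
    -- If `C` bounds `|1/f|` on `[0, a]`, then `|1/f(s) - 1/f(t)| = |f(s) - f(t)| / |f(s) f(t)| ≤ C²
    -- |f(s) - f(t)|`.
    refine absolutelyContinuousOnInterval_of_dist_le (C := C * C)
      (hf.absolutelyContinuous ha) fun s hs t ht ↦ ?_
    rw [uIcc_of_le ha] at hs ht
    rw [dist_inv_inv₀ (h0 s hs.1) (h0 t ht.1), div_eq_mul_inv, mul_inv, mul_comm, ← norm_inv,
      ← norm_inv]
    have hC0 := (norm_nonneg _).trans (hC s hs)
    gcongr
    exacts [hC s hs, hC t ht]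
  · filter_upwards [hf.ae_hasDerivAt, ae_restrict_mem measurableSet_Ioi] with x hx hx0
    convert! hx.inv (h0 x (le_of_lt hx0)) using 1
    field_simp

theorem HasWeakDeriv.ofReal {f f' : ℝ → ℝ} (h : HasWeakDeriv f f') :
    HasWeakDeriv (fun x ↦ (f x : ℂ)) (fun x ↦ (f' x : ℂ)) where
  continuousOn := Complex.continuous_ofReal.comp_continuousOn h.continuousOn
  locL2 a ha := (h.locL2 a ha).ofReal
  eq_integral x hx := by
    rw [intervalIntegral.integral_ofReal, ← Complex.ofReal_add, ← h.eq_integral x hx]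

/-! ### Tail integrals -/

/-- The tail integral `∫ₛ^∞ F`. -/
def tail (F : ℝ → ℂ) (s : ℝ) : ℂ := ∫ y in Ioi s, F y

theorem tail_eq_sub {F : ℝ → ℂ} (hF : Integrable F halfLine) {s : ℝ} (hs : 0 ≤ s) :
    tail F s = tail F 0 - ∫ y in (0 : ℝ)..s, F y := by
  rw [← intervalIntegral.integral_Ioi_sub_Ioi hF hs]
  simp [tail]

theorem intervalIntegrable_of_integrable_halfLine {E : Type*} [NormedAddCommGroup E] {F : ℝ → E}
    (hF : Integrable F halfLine) {s : ℝ} (hs : 0 ≤ s) : IntervalIntegrable F volume 0 s := by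
  rw [intervalIntegrable_iff_integrableOn_Ioc_of_le hs]
  exact IntegrableOn.mono_set hF fun x hx ↦ hx.1

theorem continuousOn_primitive_Ici {E : Type*} [NormedAddCommGroup E] [NormedSpace ℝ E]
    {p : ℝ → E} (hp : ∀ a, 0 ≤ a → IntervalIntegrable p volume 0 a) :
    ContinuousOn (fun x ↦ ∫ s in (0 : ℝ)..x, p s) (Ici 0) := by
  intro x hx
  have hx' : (0 : ℝ) ≤ x := hx
  have h := intervalIntegral.continuousOn_primitive_interval (f := p) (μ := volume) (a := 0)
    (b := x + 1) (by
      rw [uIcc_of_le (by linarith), integrableOn_Icc_iff_integrableOn_Ioc,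
        ← intervalIntegrable_iff_integrableOn_Ioc_of_le (by linarith)]
      exact hp _ (by linarith)) x (by rw [uIcc_of_le (by linarith)]; exact ⟨hx', by linarith⟩)
  rw [uIcc_of_le (by linarith)] at h
  exact h.mono_of_mem_nhdsWithin (by
    filter_upwards [self_mem_nhdsWithin, mem_nhdsWithin_of_mem_nhds
      (Iio_mem_nhds (show x < x + 1 by linarith))] with y h1 h2 using ⟨h1, le_of_lt h2⟩)

theorem continuousOn_tail {F : ℝ → ℂ} (hF : Integrable F halfLine) :
    ContinuousOn (tail F) (Ici 0) :=
  (continuousOn_const.sub (continuousOn_primitive_Ici fun _ ha ↦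
    intervalIntegrable_of_integrable_halfLine hF ha)).congr fun _ hs ↦ tail_eq_sub hF hs

theorem tendsto_tail {F : ℝ → ℂ} (hF : Integrable F halfLine) :
    Tendsto (tail F) atTop (𝓝 0) := by
  have h := (intervalIntegral_tendsto_integral_Ioi 0 hF tendsto_id).const_sub (tail F 0)
  rw [show tail F 0 - ∫ x in Ioi 0, F x = 0 from sub_self _] at h
  refine h.congr' ?_
  filter_upwards [eventually_ge_atTop 0] with s hs using (tail_eq_sub hF hs).symm

/-- Fubini's theorem on the region `0 < s < y`. -/
theorem integral_mul_tail {p F : ℝ → ℂ} (hpm : AEStronglyMeasurable p halfLine)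
    (hp : ∀ a, 0 ≤ a → IntervalIntegrable p volume 0 a) (hF : AEStronglyMeasurable F halfLine)
    (hpF : Integrable (fun y ↦ F y * (∫ s in (0 : ℝ)..y, ‖p s‖ : ℝ)) halfLine) :
    Integrable (fun s ↦ p s * tail F s) halfLine ∧
    Integrable (fun y ↦ F y * ∫ s in (0 : ℝ)..y, p s) halfLine ∧
    ∫ s, p s * tail F s ∂halfLine = ∫ y, (F y * ∫ s in (0 : ℝ)..y, p s) ∂halfLine := by
  set Φ : ℝ × ℝ → ℂ := {z : ℝ × ℝ | z.1 < z.2}.indicator fun z ↦ p z.1 * F z.2 with hΦ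
  have hΦm : AEStronglyMeasurable Φ (halfLine.prod halfLine) :=
    (hpm.comp_fst.mul hF.comp_snd).indicator (measurableSet_lt measurable_fst measurable_snd)
  have hfst (y : ℝ) : (fun s ↦ Φ (s, y)) = (Iio y).indicator fun s ↦ p s * F y := by
    ext s; simp [hΦ, indicator, mem_Iio]
  have hsnd (s : ℝ) : (fun y ↦ Φ (s, y)) = (Ioi s).indicator fun y ↦ p s * F y := by
    ext y; simp [hΦ, indicator, mem_Ioi]
  have hrest (y : ℝ) : (halfLine).restrict (Iio y) = volume.restrict (Ioo 0 y) := by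
    rw [Measure.restrict_restrict measurableSet_Iio, inter_comm, Ioi_inter_Iio]
  have hint {E : Type} [NormedAddCommGroup E] [NormedSpace ℝ E] (f : ℝ → E) {y : ℝ} (hy : 0 ≤ y) :
      ∫ s in Iio y, f s ∂halfLine = ∫ s in (0 : ℝ)..y, f s := by
    rw [hrest, ← integral_Ioc_eq_integral_Ioo, intervalIntegral.integral_of_le hy]
  have hmem : ∀ᵐ y ∂halfLine, 0 < y := ae_restrict_mem measurableSet_Ioi
  have hΦi : Integrable Φ (halfLine.prod halfLine) := by
    rw [integrable_prod_iff' hΦm]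
    constructor
    · filter_upwards [hmem] with y hy
      rw [hfst, integrable_indicator_iff measurableSet_Iio, IntegrableOn, hrest]
      exact ((intervalIntegrable_iff_integrableOn_Ioo_of_le hy.le).1 (hp y hy.le)).mul_const _
    -- Integrating `‖Φ‖` over `s` leaves `‖F y‖ ∫₀ʸ ‖p‖`, so `hpF` is exactly Tonelli's condition.
    · refine hpF.norm.congr ?_
      filter_upwards [hmem] with y hy
      have : (fun s ↦ ‖Φ (s, y)‖) = (Iio y).indicator fun s ↦ ‖p s‖ * ‖F y‖ := by
        ext s
        rw [show Φ (s, y) = _ from congrFun (hfst y) s, norm_indicator_eq_indicator_norm]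
        simp
      rw [this, integral_indicator measurableSet_Iio, hint _ hy.le,
        intervalIntegral.integral_mul_const, norm_mul, Complex.norm_real, Real.norm_of_nonneg
        (intervalIntegral.integral_nonneg hy.le fun _ _ ↦ norm_nonneg _), mul_comm]
  have h1 : (fun s ↦ ∫ y, Φ (s, y) ∂halfLine) =ᵐ[halfLine] fun s ↦ p s * tail F s := by
    filter_upwards [hmem] with s hs
    rw [hsnd, integral_indicator measurableSet_Ioi, Measure.restrict_restrict measurableSet_Ioi,
      inter_eq_left.2 (Ioi_subset_Ioi hs.le), integral_const_mul]
    rfl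
  have h2 : (fun y ↦ ∫ s, Φ (s, y) ∂halfLine) =ᵐ[halfLine]
      fun y ↦ F y * ∫ s in (0 : ℝ)..y, p s := by
    filter_upwards [hmem] with y hy
    rw [hfst, integral_indicator measurableSet_Iio, hint _ hy.le,
      intervalIntegral.integral_mul_const, mul_comm]
  exact ⟨hΦi.integral_prod_left.congr h1, hΦi.integral_prod_right.congr h2, by
    rw [← integral_congr_ae h1, ← integral_congr_ae h2]
    exact integral_integral_swap (f := fun s y ↦ Φ (s, y)) hΦi⟩

/-! ### The function `∫₀ˣ φ⁻²` -/

/-- The ratio `ψ / φ`, that is, `∫₀ˣ φ⁻²`. -/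
def invSqPrimitive (φ : ℝ → ℝ) (x : ℝ) : ℝ := ∫ s in (0 : ℝ)..x, (φ s ^ 2)⁻¹

theorem psi_eq (φ : ℝ → ℝ) (x : ℝ) : psi φ x = φ x * invSqPrimitive φ x := rfl

theorem intervalIntegrable_of_continuousOn_Ici {E : Type*} [NormedAddCommGroup E] {p : ℝ → E}
    (hp : ContinuousOn p (Ici 0)) {a : ℝ} (ha : 0 ≤ a) : IntervalIntegrable p volume 0 a :=
  (hp.mono (by rw [uIcc_of_le ha]; exact fun x hx ↦ hx.1)).intervalIntegrable

theorem aestronglyMeasurable_of_continuousOn_Ici {p : ℝ → ℂ}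
    (hp : ContinuousOn p (Ici 0)) : AEStronglyMeasurable p halfLine :=
  (hp.mono Ioi_subset_Ici_self).aestronglyMeasurable measurableSet_Ioi

theorem continuousOn_inv_sq {φ : ℝ → ℝ}
    (hpos : ∀ x : ℝ, 0 ≤ x → 0 < φ x) (hc : ContinuousOn φ (Ici 0)) : ContinuousOn (fun s ↦ (φ s ^ 2)⁻¹) (Ici 0) :=
  (hc.pow 2).inv₀ fun x hx ↦ pow_ne_zero 2 (hpos x hx).ne'

theorem continuousOn_ofReal_inv_sq {φ : ℝ → ℝ}
    (hpos : ∀ x : ℝ, 0 ≤ x → 0 < φ x) (hc : ContinuousOn φ (Ici 0)) : ContinuousOn (fun s ↦ ((φ s : ℂ) ^ 2)⁻¹) (Ici 0) :=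
  ((Complex.continuous_ofReal.comp_continuousOn hc).pow 2).inv₀ fun x hx ↦
    pow_ne_zero 2 (Complex.ofReal_ne_zero.2 (hpos x hx).ne')

/-- By the arithmetic-geometric inequality `φ⁻² ≥ 2 - φ²`, so the primitive is at least `2x - ∫ φ²`,
which tends to infinity because `φ ∈ L²`. -/
theorem tendsto_invSqPrimitive {φ : ℝ → ℝ}
    (hpos : ∀ x : ℝ, 0 ≤ x → 0 < φ x) (hc : ContinuousOn φ (Ici 0)) (hL2 : MemLp φ 2 halfLine) :
    Tendsto (invSqPrimitive φ) atTop atTop := by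
  have hsq : Integrable (fun x ↦ φ x ^ 2) halfLine := hL2.integrable_sq
  have hlin : Tendsto (fun x : ℝ ↦ 2 * x - ∫ s, φ s ^ 2 ∂halfLine) atTop atTop :=
    tendsto_atTop_add_const_right _ _ (tendsto_id.const_mul_atTop (by norm_num))
  refine tendsto_atTop_mono' _ ?_ hlin
  filter_upwards [eventually_ge_atTop 0] with x hx
  have hi1 := intervalIntegrable_of_continuousOn_Ici (continuousOn_inv_sq hpos hc) hx
  have hi2 := intervalIntegrable_of_integrable_halfLine hsq hx
  have h1 : ∫ s in (0 : ℝ)..x, (2 - φ s ^ 2) ≤ invSqPrimitive φ x := by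
    refine intervalIntegral.integral_mono_on hx (by simp [hi2]) hi1 fun s hs ↦ ?_
    have h := hpos s hs.1
    rw [← sub_nonneg]
    have : (φ s ^ 2)⁻¹ - (2 - φ s ^ 2) = ((φ s)⁻¹ - φ s) ^ 2 := by field_simp; ring
    rw [this]; positivity
  rw [intervalIntegral.integral_sub (by simp) hi2, intervalIntegral.integral_const] at h1
  have h2 : ∫ s in (0 : ℝ)..x, φ s ^ 2 ≤ ∫ s, φ s ^ 2 ∂halfLine := by
    rw [intervalIntegral.integral_of_le hx]
    exact setIntegral_mono_set hsq (Eventually.of_forall fun _ ↦ sq_nonneg _)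
      (LE.le.eventuallyLE fun x hx ↦ hx.1)
  simp only [sub_zero, smul_eq_mul] at h1
  linarith

/-- A Cesàro argument: the quotient is an average of `A` with weight `φ⁻²`, whose total mass is
infinite, so neither `K` nor any bounded range of `s` affects the limit. -/
theorem tendsto_div_invSqPrimitive {φ : ℝ → ℝ}
    (hpos : ∀ x : ℝ, 0 ≤ x → 0 < φ x) (hc : ContinuousOn φ (Ici 0)) (hL2 : MemLp φ 2 halfLine) {A : ℝ → ℂ} {c : ℂ}
    (hA : ContinuousOn A (Ici 0)) (hlim : Tendsto A atTop (𝓝 c)) (K : ℂ) :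
    Tendsto (fun x ↦ (K + ∫ s in (0 : ℝ)..x, ((φ s : ℂ) ^ 2)⁻¹ * A s) / (invSqPrimitive φ x : ℂ))
      atTop (𝓝 c) := by
  have hQ := tendsto_invSqPrimitive hpos hc hL2
  have hqc := continuousOn_ofReal_inv_sq hpos hc
  have hB : ContinuousOn (fun s ↦ ((φ s : ℂ) ^ 2)⁻¹ * (A s - c)) (Ici 0) :=
    hqc.mul (hA.sub continuousOn_const)
  rw [Metric.tendsto_atTop] at hlim ⊢
  intro ε hε
  obtain ⟨X₀, hX₀⟩ := hlim (ε / 3) (by positivity)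
  set X := max X₀ 0
  have hX : 0 ≤ X := le_max_right _ _
  set M : ℝ := ‖K + ∫ s in (0 : ℝ)..X, ((φ s : ℂ) ^ 2)⁻¹ * (A s - c)‖
  -- Beyond `Y` the contribution `M` of `[0, X]` and of `K` is below a third of `ε Q`; the added `1`
  -- makes `Q` positive even when `M = 0`.
  obtain ⟨Y, hY⟩ := (tendsto_atTop.1 hQ (3 * M / ε + 1)).exists_forall_of_atTop
  refine ⟨max X Y, fun x hx ↦ ?_⟩
  have hxX : X ≤ x := (le_max_left _ _).trans hx
  have hx0 : 0 ≤ x := hX.trans hxX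
  have hQx := hY x ((le_max_right _ _).trans hx)
  have hQpos : 0 < invSqPrimitive φ x := by
    have : 0 ≤ 3 * M / ε := by positivity
    linarith
  have hi {p : ℝ → ℂ} (hp : ContinuousOn p (Ici 0)) : IntervalIntegrable p volume X x :=
    (hp.mono (by rw [uIcc_of_le hxX]; exact fun y hy ↦ hX.trans hy.1)).intervalIntegrable
  have hQc : ∫ s in (0 : ℝ)..x, ((φ s : ℂ) ^ 2)⁻¹ = (invSqPrimitive φ x : ℂ) := by
    rw [invSqPrimitive, ← intervalIntegral.integral_ofReal]; push_cast; rfl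
  have hsplit : K + ∫ s in (0 : ℝ)..x, ((φ s : ℂ) ^ 2)⁻¹ * A s = c * invSqPrimitive φ x +
      ((K + ∫ s in (0 : ℝ)..X, ((φ s : ℂ) ^ 2)⁻¹ * (A s - c)) +
        ∫ s in X..x, ((φ s : ℂ) ^ 2)⁻¹ * (A s - c)) := by
    rw [add_assoc, intervalIntegral.integral_add_adjacent_intervals
      (intervalIntegrable_of_continuousOn_Ici hB hX) (hi hB)]
    simp_rw [mul_sub]
    rw [intervalIntegral.integral_sub (f := fun s ↦ ((φ s : ℂ) ^ 2)⁻¹ * A s)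
      (g := fun s ↦ ((φ s : ℂ) ^ 2)⁻¹ * c)
      (intervalIntegrable_of_continuousOn_Ici (hqc.mul hA) hx0)
      (intervalIntegrable_of_continuousOn_Ici (hqc.mul continuousOn_const) hx0),
      intervalIntegral.integral_mul_const, hQc]
    ring
  have hbound : ‖∫ s in X..x, ((φ s : ℂ) ^ 2)⁻¹ * (A s - c)‖ ≤ ε / 3 * invSqPrimitive φ x := by
    have hqi {a : ℝ} (ha : 0 ≤ a) :=
      intervalIntegrable_of_continuousOn_Ici (continuousOn_inv_sq hpos hc) ha
    have hqX : IntervalIntegrable (fun s ↦ (φ s ^ 2)⁻¹) volume X x :=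
      (hqi hX).symm.trans (hqi hx0)
    have h1 : ‖∫ s in X..x, ((φ s : ℂ) ^ 2)⁻¹ * (A s - c)‖ ≤
        ∫ s in X..x, (φ s ^ 2)⁻¹ * (ε / 3) := by
      refine intervalIntegral.norm_integral_le_of_norm_le hxX
        (Eventually.of_forall fun s hs ↦ ?_) (hqX.mul_const _)
      rw [norm_mul, norm_inv, norm_pow, Complex.norm_real, Real.norm_eq_abs, sq_abs]
      refine mul_le_mul_of_nonneg_left ?_ (by positivity)
      rw [← dist_eq_norm]
      exact (hX₀ s ((le_max_left _ _).trans hs.1.le)).le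
    rw [intervalIntegral.integral_mul_const] at h1
    have h2 : ∫ s in X..x, (φ s ^ 2)⁻¹ ≤ invSqPrimitive φ x := by
      rw [invSqPrimitive, ← intervalIntegral.integral_add_adjacent_intervals (hqi hX) hqX]
      exact le_add_of_nonneg_left
        (intervalIntegral.integral_nonneg hX fun s _ ↦ by positivity)
    nlinarith
  have hne : (invSqPrimitive φ x : ℂ) ≠ 0 := Complex.ofReal_ne_zero.2 hQpos.ne'
  rw [hsplit, dist_eq_norm, add_div, mul_div_cancel_right₀ _ hne, add_sub_cancel_left, norm_div,
    Complex.norm_real, Real.norm_of_nonneg hQpos.le, div_lt_iff₀ hQpos]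
  have hM : 3 * M < ε * invSqPrimitive φ x := by
    have : 3 * M / ε < invSqPrimitive φ x := by linarith
    rw [div_lt_iff₀ hε] at this
    linarith
  calc _ ≤ M + ε / 3 * invSqPrimitive φ x := (norm_add_le _ _).trans (by gcongr)
    _ < _ := by nlinarith [mul_pos hε hQpos]

/-! ### The Green functions -/

theorem dirichletGreen_eq (φ : ℝ → ℝ) (x y : ℝ) :
    dirichletGreen φ x y = φ x * (invSqPrimitive φ (min x y) * φ y) := by
  unfold dirichletGreen greenKernel
  split_ifs with h
  · simp only [min_eq_left h, psi_eq]; push_cast; ring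
  · simp only [min_eq_right (not_le.1 h).le, psi_eq]; push_cast; ring

theorem robinGreen_eq (φ : ℝ → ℝ) (γ : ℂ) (x y : ℝ) :
    robinGreen φ γ x y = dirichletGreen φ x y + γ * φ x * φ y := by
  unfold robinGreen dirichletGreen greenKernel xi
  split_ifs <;> ring

theorem integral_indicator_le {E : Type*} [NormedAddCommGroup E] [NormedSpace ℝ E] (r : ℝ → E)
    {x y : ℝ} (hx : 0 ≤ x) (hy : 0 ≤ y) :
    ∫ s in (0 : ℝ)..y, {s | s ≤ x}.indicator r s = ∫ s in (0 : ℝ)..min x y, r s := by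
  rcases le_total x y with h | h
  · rw [min_eq_left h, intervalIntegral.integral_indicator ⟨hx, h⟩]
  · rw [min_eq_right h]
    refine intervalIntegral.integral_congr fun s hs ↦ ?_
    rw [uIcc_of_le hy] at hs
    exact indicator_of_mem (s := {s | s ≤ x}) (hs.2.trans h) r

theorem integral_ofReal_inv_sq (φ : ℝ → ℝ) (x : ℝ) :
    ∫ s in (0 : ℝ)..x, ((φ s : ℂ) ^ 2)⁻¹ = (invSqPrimitive φ x : ℂ) := by
  rw [invSqPrimitive, ← intervalIntegral.integral_ofReal]; push_cast; rfl

theorem norm_ofReal_inv_sq (r : ℝ) : ‖((r : ℂ) ^ 2)⁻¹‖ = (r ^ 2)⁻¹ := by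
  rw [norm_inv, norm_pow, Complex.norm_real, Real.norm_eq_abs, sq_abs]

/-- Since `Q(min x y) = ∫₀ʸ 1_{s ≤ x} φ(s)⁻² ds`, this is `integral_mul_tail` with `p` equal to
`φ⁻²` cut off at `x`. -/
theorem integral_green {φ : ℝ → ℝ}
    (hpos : ∀ x : ℝ, 0 ≤ x → 0 < φ x) (hc : ContinuousOn φ (Ici 0)) {F : ℝ → ℂ}
    (hF : Integrable F halfLine) {x : ℝ} (hx : 0 ≤ x) :
    Integrable (fun y ↦ (invSqPrimitive φ (min x y) : ℂ) * F y) halfLine ∧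
    ∫ y, (invSqPrimitive φ (min x y) : ℂ) * F y ∂halfLine =
      ∫ s in (0 : ℝ)..x, ((φ s : ℂ) ^ 2)⁻¹ * tail F s := by
  have hmeas : MeasurableSet {s : ℝ | s ≤ x} := measurableSet_Iic
  have hmem : ∀ᵐ y ∂halfLine, 0 < y := ae_restrict_mem measurableSet_Ioi
  have hq := continuousOn_ofReal_inv_sq hpos hc
  set p : ℝ → ℂ := {s | s ≤ x}.indicator fun s ↦ ((φ s : ℂ) ^ 2)⁻¹ with hp
  have hpm : AEStronglyMeasurable p halfLine :=
    (aestronglyMeasurable_of_continuousOn_Ici hq).indicator hmeas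
  have hpi (a : ℝ) (ha : 0 ≤ a) : IntervalIntegrable p volume 0 a := by
    have := intervalIntegrable_of_continuousOn_Ici hq ha
    rw [intervalIntegrable_iff] at this ⊢
    exact this.indicator hmeas
  have hnorm {y : ℝ} (hy : 0 ≤ y) : ∫ s in (0 : ℝ)..y, ‖p s‖ = invSqPrimitive φ (min x y) := by
    simp_rw [hp, norm_indicator_eq_indicator_norm, norm_ofReal_inv_sq]
    exact integral_indicator_le _ hx hy
  have hval {y : ℝ} (hy : 0 ≤ y) : ∫ s in (0 : ℝ)..y, p s = invSqPrimitive φ (min x y) := by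
    rw [hp, integral_indicator_le _ hx hy, integral_ofReal_inv_sq]
  -- The factor `Q(min x y)` is at most `Q(x)`, so integrability of `F` is enough.
  have hpF : Integrable (fun y ↦ F y * (∫ s in (0 : ℝ)..y, ‖p s‖ : ℝ)) halfLine := by
    refine (hF.norm.const_mul (invSqPrimitive φ x)).mono' (hF.1.mul
      (aestronglyMeasurable_of_continuousOn_Ici (Complex.continuous_ofReal.comp_continuousOn
        (continuousOn_primitive_Ici fun a ha ↦ (hpi a ha).norm)))) ?_
    filter_upwards [hmem] with y hy
    have h0 : 0 ≤ invSqPrimitive φ (min x y) :=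
      intervalIntegral.integral_nonneg (le_min hx hy.le) fun _ _ ↦ by positivity
    have h1 : invSqPrimitive φ (min x y) ≤ invSqPrimitive φ x :=
      intervalIntegral.integral_mono_interval le_rfl (le_min hx hy.le) (min_le_left _ _)
        (Eventually.of_forall fun _ ↦ by positivity)
        (intervalIntegrable_of_continuousOn_Ici (continuousOn_inv_sq hpos hc) hx)
    rw [hnorm hy.le, norm_mul, Complex.norm_real, Real.norm_of_nonneg h0, mul_comm]
    gcongr
  obtain ⟨-, h2, h3⟩ := integral_mul_tail hpm hpi hF.1 hpF
  have hcongr : (fun y ↦ F y * ∫ s in (0 : ℝ)..y, p s) =ᵐ[halfLine]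
      fun y ↦ (invSqPrimitive φ (min x y) : ℂ) * F y := by
    filter_upwards [hmem] with y hy
    rw [hval hy.le, mul_comm]
  refine ⟨h2.congr hcongr, ?_⟩
  rw [← integral_congr_ae hcongr, ← h3]
  have : (fun s ↦ p s * tail F s) =
      {s | s ≤ x}.indicator fun s ↦ ((φ s : ℂ) ^ 2)⁻¹ * tail F s := by
    ext s; simp [hp, indicator]
  rw [this, integral_indicator hmeas, Measure.restrict_restrict hmeas,
    intervalIntegral.integral_of_le hx]
  congr 2
  ext s; simp [and_comm]

theorem integrable_mul_L2 {φ : ℝ → ℝ} (hL2 : MemLp φ 2 halfLine) (f : L2) :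
    Integrable (fun y ↦ (φ y : ℂ) * f y) halfLine :=
  MemLp.integrable_mul (p := 2) (q := 2) hL2.ofReal (Lp.memLp f)

theorem dirichletGreen_apply {φ : ℝ → ℝ}
    (hpos : ∀ x : ℝ, 0 ≤ x → 0 < φ x) (hc : ContinuousOn φ (Ici 0)) (hL2 : MemLp φ 2 halfLine)
    {G : L2 →L[ℂ] L2} (hG : IsKernelOf (dirichletGreen φ) G) (f : L2) :
    G f =ᵐ[halfLine] fun x ↦ (φ x : ℂ) *
      ∫ s in (0 : ℝ)..x, ((φ s : ℂ) ^ 2)⁻¹ * tail (fun y ↦ (φ y : ℂ) * f y) s := by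
  filter_upwards [hG f, ae_restrict_mem measurableSet_Ioi] with x hx hx0
  rw [hx.2, ← (integral_green hpos hc (integrable_mul_L2 hL2 f) (le_of_lt hx0)).2,
    ← integral_const_mul]
  simp_rw [dirichletGreen_eq, mul_assoc]

/-- The operator `f ↦ G f + γ ⟨f, φ⟩ φ`. -/
def robinOperator {φ : ℝ → ℝ} (hL2 : MemLp φ 2 halfLine) (γ : ℂ) (G : L2 →L[ℂ] L2) :
    L2 →L[ℂ] L2 :=
  G + γ • (innerSL ℂ (hL2.ofReal (K := ℂ)).toLp).smulRight (hL2.ofReal (K := ℂ)).toLp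

theorem robinOperator_apply {φ : ℝ → ℝ} (hL2 : MemLp φ 2 halfLine) (γ : ℂ) (G : L2 →L[ℂ] L2)
    (f : L2) : robinOperator hL2 γ G f =ᵐ[halfLine]
      fun x ↦ G f x + γ * φ x * ∫ y, (φ y : ℂ) * f y ∂halfLine := by
  have hin : inner ℂ (hL2.ofReal (K := ℂ)).toLp f = ∫ y, (φ y : ℂ) * f y ∂halfLine := by
    rw [MeasureTheory.L2.inner_def]
    refine integral_congr_ae ?_
    filter_upwards [(hL2.ofReal (K := ℂ)).coeFn_toLp] with y hy
    rw [hy, RCLike.inner_apply]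
    simp [mul_comm]
  have happ : robinOperator hL2 γ G f =
      G f + (γ * ∫ y, (φ y : ℂ) * f y ∂halfLine) • (hL2.ofReal (K := ℂ)).toLp := by
    rw [← hin, mul_smul]; rfl
  rw [happ]
  filter_upwards [Lp.coeFn_add (G f) ((γ * ∫ y, (φ y : ℂ) * f y ∂halfLine) •
      (hL2.ofReal (K := ℂ)).toLp),
    Lp.coeFn_smul (γ * ∫ y, (φ y : ℂ) * f y ∂halfLine) (hL2.ofReal (K := ℂ)).toLp,
    (hL2.ofReal (K := ℂ)).coeFn_toLp] with x h1 h2 h3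
  rw [h1, Pi.add_apply, h2, Pi.smul_apply, h3, smul_eq_mul]
  simp only [RCLike.ofReal_eq_complex_ofReal]
  ring

theorem isKernelOf_robinOperator {φ : ℝ → ℝ} (hL2 : MemLp φ 2 halfLine) (γ : ℂ)
    {G : L2 →L[ℂ] L2} (hG : IsKernelOf (dirichletGreen φ) G) :
    IsKernelOf (robinGreen φ γ) (robinOperator hL2 γ G) := by
  intro f
  filter_upwards [hG f, robinOperator_apply hL2 γ G f] with x hx h
  have hF := (integrable_mul_L2 hL2 f).const_mul (γ * φ x)
  have heq : (fun y ↦ robinGreen φ γ x y * f y) =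
      fun y ↦ dirichletGreen φ x y * f y + γ * φ x * (φ y * f y) := by
    ext y; rw [robinGreen_eq]; ring
  rw [heq]
  exact ⟨hx.1.add hF, by rw [integral_add hx.1 hF, integral_const_mul, h, hx.2]⟩

/-- The continuous representative of `G_γ f` divided by `φ`, as a function of `F = φ f`. -/
def robinQuotient (φ : ℝ → ℝ) (γ : ℂ) (F : ℝ → ℂ) (x : ℝ) : ℂ :=
  γ * tail F 0 + ∫ s in (0 : ℝ)..x, ((φ s : ℂ) ^ 2)⁻¹ * tail F s

theorem robinOperator_ae_eq {φ : ℝ → ℝ}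
    (hpos : ∀ x : ℝ, 0 ≤ x → 0 < φ x) (hc : ContinuousOn φ (Ici 0)) (hL2 : MemLp φ 2 halfLine)
    (γ : ℂ) {G : L2 →L[ℂ] L2} (hG : IsKernelOf (dirichletGreen φ) G) (f : L2) :
    robinOperator hL2 γ G f =ᵐ[halfLine]
      fun x ↦ (φ x : ℂ) * robinQuotient φ γ (fun y ↦ (φ y : ℂ) * f y) x := by
  filter_upwards [robinOperator_apply hL2 γ G f, dirichletGreen_apply hpos hc hL2 hG f]
    with x h1 h2
  rw [h1, h2, robinQuotient, tail]
  ring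

/-! ### The domain -/

theorem hasWeakDeriv_primitive {p : ℝ → ℂ} (hp : ContinuousOn p (Ici 0)) (c : ℂ) :
    HasWeakDeriv (fun x ↦ c + ∫ s in (0 : ℝ)..x, p s) p where
  continuousOn := continuousOn_const.add
    (continuousOn_primitive_Ici fun _ ha ↦ intervalIntegrable_of_continuousOn_Ici hp ha)
  locL2 a _ := by
    simpa using memLp_Ioc_mul_of_continuousOn (f := fun _ ↦ 1) hp (memLp_const (1 : ℂ))
  eq_integral x _ := by simp

theorem hasWeakDeriv_tail {φ : ℝ → ℝ} (hc : ContinuousOn φ (Ici 0))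
    (hL2 : MemLp φ 2 halfLine) (f : L2) :
    HasWeakDeriv (tail fun y ↦ (φ y : ℂ) * f y) (fun y ↦ -((φ y : ℂ) * f y)) where
  continuousOn := continuousOn_tail (integrable_mul_L2 hL2 f)
  locL2 a _ := by
    have hf : MemLp f 2 (volume.restrict (Ioc 0 a)) :=
      (Lp.memLp f).mono_measure (Measure.restrict_mono (fun x hx ↦ hx.1) le_rfl)
    refine (memLp_Ioc_mul_of_continuousOn
      (Complex.continuous_ofReal.comp_continuousOn hc) hf).neg.ae_eq (Eventually.of_forall ?_)
    intro x
    simp [mul_comm]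
  eq_integral x hx := by
    rw [tail_eq_sub (integrable_mul_L2 hL2 f) hx, intervalIntegral.integral_neg, sub_eq_add_neg]

theorem tendsto_robinQuotient_div {φ : ℝ → ℝ}
    (hpos : ∀ x : ℝ, 0 ≤ x → 0 < φ x) (hc : ContinuousOn φ (Ici 0)) (hL2 : MemLp φ 2 halfLine)
    (γ : ℂ) (f : L2) :
    Tendsto (fun x ↦ (φ x : ℂ) * robinQuotient φ γ (fun y ↦ (φ y : ℂ) * f y) x / (psi φ x : ℂ))
      atTop (𝓝 0) := by
  have hF := integrable_mul_L2 hL2 f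
  refine (tendsto_div_invSqPrimitive hpos hc hL2 (continuousOn_tail hF) (tendsto_tail hF)
    (γ * tail (fun y ↦ (φ y : ℂ) * f y) 0)).congr' ?_
  filter_upwards [eventually_ge_atTop 0] with x hx
  rw [psi_eq, Complex.ofReal_mul,
    mul_div_mul_left _ _ (Complex.ofReal_ne_zero.2 (hpos x hx).ne'), robinQuotient]

/-- With `g = φ q` one has `φ g' - φ' g = φ² q'`, and `q' = φ⁻² tail F`. Square integrability of `g`
is assumed here; it comes from the boundedness of `G`. -/
theorem robinConditions_robinQuotient {φ φ' : ℝ → ℝ} (hpos : ∀ x : ℝ, 0 ≤ x → 0 < φ x)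
    (hL2 : MemLp φ 2 halfLine) (hφ : HasWeakDeriv φ φ') {γ : ℂ} (hγ : γ ≠ 0) (f : L2)
    (hmem : MemLp (fun x ↦ (φ x : ℂ) * robinQuotient φ γ (fun y ↦ (φ y : ℂ) * f y) x) 2
      halfLine) :
    ∃ g' : ℝ → ℂ, RobinConditions φ φ' γ
      (fun x ↦ (φ x : ℂ) * robinQuotient φ γ (fun y ↦ (φ y : ℂ) * f y) x) g'
      (tail fun y ↦ (φ y : ℂ) * f y) (fun y ↦ -((φ y : ℂ) * f y)) := by
  have hF := integrable_mul_L2 hL2 f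
  have hc := hφ.continuousOn
  have hpos0 {x : ℝ} (hx : 0 ≤ x) : (φ x : ℂ) ≠ 0 := Complex.ofReal_ne_zero.2 (hpos x hx).ne'
  refine ⟨_, hmem, hφ.ofReal.mul (hasWeakDeriv_primitive
    ((continuousOn_ofReal_inv_sq hpos hc).mul (continuousOn_tail hF))
    (γ * tail (fun y ↦ (φ y : ℂ) * f y) 0)), ?_, ?_, hasWeakDeriv_tail hc hL2 f, ?_,
    tendsto_robinQuotient_div hpos hc hL2 γ f⟩
  · have := hpos0 le_rfl
    simp only [robinQuotient, intervalIntegral.integral_same, add_zero]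
    field_simp
  · filter_upwards [ae_restrict_mem measurableSet_Ioi] with x hx
    have := hpos0 (le_of_lt hx)
    simp only [robinQuotient, Pi.mul_apply]
    field_simp
    ring
  · refine (Lp.memLp f).neg.ae_eq ?_
    filter_upwards [ae_restrict_mem measurableSet_Ioi] with x hx
    rw [Pi.neg_apply, mul_neg, inv_mul_cancel_left₀ (hpos0 (le_of_lt hx))]

theorem RobinConditions.eq_robinQuotient {φ φ' : ℝ → ℝ} (hpos : ∀ x : ℝ, 0 ≤ x → 0 < φ x)
    (hL2 : MemLp φ 2 halfLine) (hφ : HasWeakDeriv φ φ') {γ : ℂ} (hγ : γ ≠ 0)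
    {g g' w w' : ℝ → ℂ} (h : RobinConditions φ φ' γ g g' w w') {f : L2}
    (hf : f =ᵐ[halfLine] fun x ↦ (φ x : ℂ)⁻¹ * (-w' x)) {x : ℝ} (hx : 0 ≤ x) :
    w x = tail (fun y ↦ (φ y : ℂ) * f y) x ∧
      g x = (φ x : ℂ) * robinQuotient φ γ (fun y ↦ (φ y : ℂ) * f y) x := by
  have hF := integrable_mul_L2 hL2 f
  have hc := hφ.continuousOn
  have hpos0 {x : ℝ} (hx : 0 ≤ x) : (φ x : ℂ) ≠ 0 := Complex.ofReal_ne_zero.2 (hpos x hx).ne'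
  set F : ℝ → ℂ := fun y ↦ (φ y : ℂ) * f y with hFdef
  have hwF : w' =ᵐ[halfLine] fun y ↦ -F y := by
    filter_upwards [hf, ae_restrict_mem measurableSet_Ioi] with y hy hy0
    simp only [hFdef]
    rw [hy, mul_inv_cancel_left₀ (hpos0 (le_of_lt hy0)), neg_neg]
  have hcongr {u v : ℝ → ℂ} (huv : u =ᵐ[halfLine] v) {x : ℝ} (hx : 0 ≤ x) :
      ∫ s in (0 : ℝ)..x, u s = ∫ s in (0 : ℝ)..x, v s := by
    rw [intervalIntegral.integral_of_le hx, intervalIntegral.integral_of_le hx]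
    exact integral_congr_ae (ae_restrict_of_ae_restrict_of_subset (fun y hy ↦ hy.1) huv)
  -- Both `w` and the tail have derivative `-F`, so they differ by a constant.
  have hw {x : ℝ} (hx : 0 ≤ x) : w x = (w 0 - tail F 0) + tail F x := by
    rw [h.quasi_weakDeriv.eq_integral x hx, hcongr hwF hx, intervalIntegral.integral_neg,
      tail_eq_sub hF hx]
    ring
  have hwlim : Tendsto w atTop (𝓝 (w 0 - tail F 0)) := by
    have := (tendsto_tail hF).const_add (w 0 - tail F 0)
    rw [add_zero] at this
    refine this.congr' ?_
    filter_upwards [eventually_ge_atTop 0] with x hx using (hw hx).symm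
  -- The quotient rule: `(g/φ)' = φ⁻² (φ g' - φ' g) = φ⁻² w`.
  have hg {x : ℝ} (hx : 0 ≤ x) :
      g x * (φ x : ℂ)⁻¹ = g 0 * (φ 0 : ℂ)⁻¹ + ∫ s in (0 : ℝ)..x, ((φ s : ℂ) ^ 2)⁻¹ * w s := by
    rw [(h.weakDeriv.mul (hφ.ofReal.inv fun x hx ↦ hpos0 hx)).eq_integral x hx]
    congr 1
    refine hcongr ?_ hx
    filter_upwards [h.quasi_eq, ae_restrict_mem measurableSet_Ioi] with y hy hy0
    have := hpos0 (le_of_lt hy0)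
    rw [hy]
    field_simp
    ring
  -- The averaging lemma gives `g/ψ` the same limit as `w`, and the decay condition says that this
  -- limit is zero.
  have hc0 : w 0 - tail F 0 = 0 := by
    refine tendsto_nhds_unique (tendsto_div_invSqPrimitive hpos hc hL2
      h.quasi_weakDeriv.continuousOn hwlim (g 0 * (φ 0 : ℂ)⁻¹)) (h.decay.congr' ?_)
    filter_upwards [eventually_ge_atTop 0] with x hx
    rw [← hg hx, psi_eq, Complex.ofReal_mul, ← div_eq_mul_inv, div_div]
  have hw' {x : ℝ} (hx : 0 ≤ x) : w x = tail F x := by rw [hw hx, hc0, zero_add]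
  refine ⟨hw' hx, ?_⟩
  have hg0 : g 0 * (φ 0 : ℂ)⁻¹ = γ * tail F 0 := by
    have := hpos0 le_rfl
    rw [← hw' le_rfl, h.boundary]
    field_simp
  rw [robinQuotient, ← hg0, ← intervalIntegral.integral_congr (f := fun s ↦
    ((φ s : ℂ) ^ 2)⁻¹ * w s), ← hg hx, mul_comm, inv_mul_cancel_right₀ (hpos0 hx)]
  intro s hs
  rw [uIcc_of_le hx] at hs
  simp only [hw' hs.1]

theorem RobinConditions.exists_image {φ φ' : ℝ → ℝ} {γ : ℂ}
    {g g' w w' : ℝ → ℂ} (h : RobinConditions φ φ' γ g g' w w') :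
    ∃ f : L2, f =ᵐ[halfLine] fun x ↦ (φ x : ℂ)⁻¹ * (-w' x) := by
  refine ⟨h.image_memL2.neg.toLp, h.image_memL2.neg.coeFn_toLp.trans (Eventually.of_forall ?_)⟩
  intro x
  simp

theorem RobinConditions.robinOperator_eq {φ φ' : ℝ → ℝ} (hpos : ∀ x : ℝ, 0 ≤ x → 0 < φ x)
    (hL2 : MemLp φ 2 halfLine) (hφ : HasWeakDeriv φ φ') {γ : ℂ} (hγ : γ ≠ 0)
    {G : L2 →L[ℂ] L2} (hG : IsKernelOf (dirichletGreen φ) G)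
    {g g' w w' : ℝ → ℂ} (h : RobinConditions φ φ' γ g g' w w') {f u : L2}
    (hf : f =ᵐ[halfLine] fun x ↦ (φ x : ℂ)⁻¹ * (-w' x)) (hu : u =ᵐ[halfLine] g) :
    robinOperator hL2 γ G f = u := by
  refine Lp.ext ?_
  filter_upwards [robinOperator_ae_eq hpos hφ.continuousOn hL2 γ hG f, hu,
    ae_restrict_mem measurableSet_Ioi] with x h1 h2 hx
  rw [h1, h2, (h.eq_robinQuotient hpos hL2 hφ hγ hf (le_of_lt hx)).2]

theorem robinConditions_robinOperator {φ φ' : ℝ → ℝ} (hpos : ∀ x : ℝ, 0 ≤ x → 0 < φ x)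
    (hL2 : MemLp φ 2 halfLine) (hφ : HasWeakDeriv φ φ') {γ : ℂ} (hγ : γ ≠ 0)
    {G : L2 →L[ℂ] L2} (hG : IsKernelOf (dirichletGreen φ) G) (f : L2) :
    ∃ g' : ℝ → ℂ, RobinConditions φ φ' γ
      (fun x ↦ (φ x : ℂ) * robinQuotient φ γ (fun y ↦ (φ y : ℂ) * f y) x) g'
      (tail fun y ↦ (φ y : ℂ) * f y) (fun y ↦ -((φ y : ℂ) * f y)) :=
  robinConditions_robinQuotient hpos hL2 hφ hγ f
    ((Lp.memLp _).ae_eq (robinOperator_ae_eq hpos hφ.continuousOn hL2 γ hG f))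

/-- If `G_γ f = 0`, its continuous representative vanishes on `(0,∞)`. Uniqueness of weak
derivatives then gives in turn `g' = 0`, `w = 0` and `w' = -φ f = 0` almost everywhere. -/
theorem injective_robinOperator {φ φ' : ℝ → ℝ} (hpos : ∀ x : ℝ, 0 ≤ x → 0 < φ x)
    (hL2 : MemLp φ 2 halfLine) (hφ : HasWeakDeriv φ φ') {γ : ℂ} (hγ : γ ≠ 0)
    {G : L2 →L[ℂ] L2} (hG : IsKernelOf (dirichletGreen φ) G) :
    Function.Injective (robinOperator hL2 γ G) := by
  rw [injective_iff_map_eq_zero]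
  intro f hf
  obtain ⟨g', h⟩ := robinConditions_robinOperator hpos hL2 hφ hγ hG f
  have hg0 : ∀ x, 0 < x →
      (φ x : ℂ) * robinQuotient φ γ (fun y ↦ (φ y : ℂ) * f y) x = 0 := by
    have hae := robinOperator_ae_eq hpos hφ.continuousOn hL2 γ hG f
    rw [hf] at hae
    have hz := hae.symm.trans (Lp.coeFn_zero ℂ 2 halfLine)
    exact Measure.eqOn_open_of_ae_eq hz isOpen_Ioi
      (h.weakDeriv.continuousOn.mono Ioi_subset_Ici_self) continuousOn_const
  have hzero : HasWeakDeriv (fun _ : ℝ ↦ (0 : ℂ)) (fun _ ↦ 0) := by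
    simpa using hasWeakDeriv_primitive (p := fun _ ↦ 0) continuousOn_const 0
  have hg' := h.weakDeriv.unique hzero hg0
  have hw : tail (fun y ↦ (φ y : ℂ) * f y) =ᵐ[halfLine] fun _ ↦ 0 := by
    filter_upwards [h.quasi_eq, hg', ae_restrict_mem measurableSet_Ioi] with x h1 h2 hx
    rw [h1, h2, hg0 x hx]; simp
  have hw' := h.quasi_weakDeriv.unique hzero (Measure.eqOn_open_of_ae_eq hw isOpen_Ioi
    (h.quasi_weakDeriv.continuousOn.mono Ioi_subset_Ici_self) continuousOn_const)
  refine Lp.ext ?_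
  filter_upwards [hw', Lp.coeFn_zero ℂ 2 halfLine, ae_restrict_mem measurableSet_Ioi]
    with x h1 h2 hx
  have := Complex.ofReal_ne_zero.2 (hpos x (le_of_lt hx)).ne'
  rw [h2]
  simpa [this] using h1

theorem range_robinOperator {φ φ' : ℝ → ℝ} (hpos : ∀ x : ℝ, 0 ≤ x → 0 < φ x)
    (hL2 : MemLp φ 2 halfLine) (hφ : HasWeakDeriv φ φ') {γ : ℂ} (hγ : γ ≠ 0)
    {G : L2 →L[ℂ] L2} (hG : IsKernelOf (dirichletGreen φ) G) :
    range (robinOperator hL2 γ G) = robinDomain φ φ' γ := by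
  ext u
  constructor
  · rintro ⟨f, rfl⟩
    obtain ⟨g', h⟩ := robinConditions_robinOperator hpos hL2 hφ hγ hG f
    exact ⟨_, _, _, _, robinOperator_ae_eq hpos hφ.continuousOn hL2 γ hG f, h⟩
  · rintro ⟨g, g', w, w', hu, h⟩
    obtain ⟨f, hf⟩ := h.exists_image
    exact ⟨f, h.robinOperator_eq hpos hL2 hφ hγ hG hf hu⟩

/-! ### The inverse operator -/

theorem inverseOp_domain (T : L2 →L[ℂ] L2) : ((inverseOp T).domain : Set L2) = range T := by
  rw [inverseOp, LinearPMap.inverse_domain]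
  ext u
  simp [LinearMap.mem_range, LinearMap.toPMap]

theorem inverseOp_apply_eq {T : L2 →L[ℂ] L2} (hT : Function.Injective T)
    (u : (inverseOp T).domain) {f : L2} (hf : T f = u) : inverseOp T u = f := by
  have hker : ((T : L2 →ₗ[ℂ] L2).toPMap ⊤).toFun.ker = ⊥ := by
    rw [LinearMap.ker_eq_bot]
    intro a b hab
    exact Subtype.ext (hT hab)
  exact LinearPMap.inverse_apply_eq hker (x := ⟨f, trivial⟩) hf

/-! ### The quadratic form -/

/-- This is `integral_mul_tail` with `p = φ⁻² conj A₂` and `F = φ f₁`. Its absolute integrability is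
not automatic: it follows because `G` maps `|f₂|` into `L²`, where it pairs with `|f₁|`. -/
theorem integral_green_form {φ : ℝ → ℝ}
    (hpos : ∀ x : ℝ, 0 ≤ x → 0 < φ x) (hc : ContinuousOn φ (Ici 0)) (hL2 : MemLp φ 2 halfLine)
    {G : L2 →L[ℂ] L2} (hG : IsKernelOf (dirichletGreen φ) G) (f₁ f₂ : L2) :
    Integrable (fun s ↦ ((φ s : ℂ) ^ 2)⁻¹ *
      starRingEnd ℂ (tail (fun y ↦ (φ y : ℂ) * f₂ y) s) *
        tail (fun y ↦ (φ y : ℂ) * f₁ y) s) halfLine ∧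
    Integrable (fun y ↦ (φ y : ℂ) * f₁ y * starRingEnd ℂ (∫ s in (0 : ℝ)..y, ((φ s : ℂ) ^ 2)⁻¹ *
      tail (fun y ↦ (φ y : ℂ) * f₂ y) s)) halfLine ∧
    ∫ s, ((φ s : ℂ) ^ 2)⁻¹ * starRingEnd ℂ (tail (fun y ↦ (φ y : ℂ) * f₂ y) s) *
        tail (fun y ↦ (φ y : ℂ) * f₁ y) s ∂halfLine =
      ∫ y, (φ y : ℂ) * f₁ y * starRingEnd ℂ (∫ s in (0 : ℝ)..y, ((φ s : ℂ) ^ 2)⁻¹ *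
        tail (fun y ↦ (φ y : ℂ) * f₂ y) s) ∂halfLine := by
  have hF₁ := integrable_mul_L2 hL2 f₁
  have hF₂ := integrable_mul_L2 hL2 f₂
  have hmem : ∀ᵐ y ∂halfLine, 0 < y := ae_restrict_mem measurableSet_Ioi
  have hpc : ContinuousOn (fun s ↦ ((φ s : ℂ) ^ 2)⁻¹ *
      starRingEnd ℂ (tail (fun y ↦ (φ y : ℂ) * f₂ y) s)) (Ici 0) :=
    (continuousOn_ofReal_inv_sq hpos hc).mul
      (Complex.continuous_conj.comp_continuousOn (continuousOn_tail hF₂))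
  have hconj (y : ℝ) : starRingEnd ℂ (∫ s in (0 : ℝ)..y, ((φ s : ℂ) ^ 2)⁻¹ *
      tail (fun y ↦ (φ y : ℂ) * f₂ y) s) = ∫ s in (0 : ℝ)..y, ((φ s : ℂ) ^ 2)⁻¹ *
      starRingEnd ℂ (tail (fun y ↦ (φ y : ℂ) * f₂ y) s) := by
    rw [intervalIntegral, intervalIntegral, map_sub, ← integral_conj, ← integral_conj]
    simp
  simp_rw [hconj]
  refine integral_mul_tail (aestronglyMeasurable_of_continuousOn_Ici hpc)
    (fun a ha ↦ intervalIntegrable_of_continuousOn_Ici hpc ha) hF₁.1 ?_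
  -- The integrand is dominated by `|f₁| G |f₂|`.
  have habs : MemLp (fun y ↦ ((‖f₂ y‖ : ℝ) : ℂ)) 2 halfLine := (Lp.memLp f₂).norm.ofReal
  -- `b` is `|f₂|` as an element of `L²`, so that `G` can act on it; its tail is real and dominates
  -- the norm of the tail of `φ f₂`.
  set b : L2 := habs.toLp with hb
  have hbF : (fun y ↦ (φ y : ℂ) * b y) =ᵐ[halfLine] fun y ↦ ((φ y * ‖f₂ y‖ : ℝ) : ℂ) := by
    filter_upwards [habs.coeFn_toLp] with y hy
    rw [hb, hy]; push_cast; rfl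
  have htail {s : ℝ} (hs : 0 ≤ s) : tail (fun y ↦ (φ y : ℂ) * b y) s =
      ((∫ y in Ioi s, φ y * ‖f₂ y‖ : ℝ) : ℂ) := by
    rw [tail, ← integral_complex_ofReal]
    exact integral_congr_ae (ae_restrict_of_ae_restrict_of_subset (Ioi_subset_Ioi hs) hbF)
  have hle {s : ℝ} (hs : 0 ≤ s) : ‖tail (fun y ↦ (φ y : ℂ) * f₂ y) s‖ ≤
      ∫ y in Ioi s, φ y * ‖f₂ y‖ := by
    refine (norm_integral_le_integral_norm _).trans (le_of_eq ?_)
    refine setIntegral_congr_fun measurableSet_Ioi fun y hy ↦ ?_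
    simp only [norm_mul, Complex.norm_real]
    rw [Real.norm_of_nonneg (hpos y (hs.trans (le_of_lt hy))).le]
  have hbc : ContinuousOn (fun s ↦ (φ s ^ 2)⁻¹ * ∫ y in Ioi s, φ y * ‖f₂ y‖) (Ici 0) := by
    refine (continuousOn_inv_sq hpos hc).mul ?_
    refine (Complex.continuous_re.comp_continuousOn
      (continuousOn_tail (integrable_mul_L2 hL2 b))).congr fun s hs ↦ ?_
    rw [Function.comp_apply, htail hs, Complex.ofReal_re]
  have hmaj : Integrable (fun y ↦ ‖f₁ y‖ * ‖G b y‖) halfLine :=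
    MemLp.integrable_mul (p := 2) (q := 2) (Lp.memLp f₁).norm (Lp.memLp (G b)).norm
  refine hmaj.mono' (hF₁.1.mul (aestronglyMeasurable_of_continuousOn_Ici
    (Complex.continuous_ofReal.comp_continuousOn (continuousOn_primitive_Ici fun a ha ↦
      (intervalIntegrable_of_continuousOn_Ici hpc ha).norm)))) ?_
  filter_upwards [dirichletGreen_apply hpos hc hL2 hG b, hmem] with y hy hy0
  have hGb : ∫ s in (0 : ℝ)..y, ((φ s : ℂ) ^ 2)⁻¹ * tail (fun y ↦ (φ y : ℂ) * b y) s =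
      ((∫ s in (0 : ℝ)..y, (φ s ^ 2)⁻¹ * ∫ y in Ioi s, φ y * ‖f₂ y‖ : ℝ) : ℂ) := by
    rw [← intervalIntegral.integral_ofReal]
    refine intervalIntegral.integral_congr fun s hs ↦ ?_
    rw [uIcc_of_le hy0.le] at hs
    simp only [htail hs.1]
    push_cast; rfl
  have hmono : ∫ s in (0 : ℝ)..y, ‖((φ s : ℂ) ^ 2)⁻¹ *
      starRingEnd ℂ (tail (fun y ↦ (φ y : ℂ) * f₂ y) s)‖ ≤
      ∫ s in (0 : ℝ)..y, (φ s ^ 2)⁻¹ * ∫ y in Ioi s, φ y * ‖f₂ y‖ := by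
    refine intervalIntegral.integral_mono_on hy0.le
      (intervalIntegrable_of_continuousOn_Ici hpc hy0.le).norm
      (intervalIntegrable_of_continuousOn_Ici hbc hy0.le) fun s hs ↦ ?_
    rw [norm_mul, norm_ofReal_inv_sq, RCLike.norm_conj]
    exact mul_le_mul_of_nonneg_left (hle hs.1) (by positivity)
  have hnn := intervalIntegral.integral_nonneg (μ := volume) hy0.le fun s _ ↦
    norm_nonneg (((φ s : ℂ) ^ 2)⁻¹ * starRingEnd ℂ (tail (fun y ↦ (φ y : ℂ) * f₂ y) s))
  rw [hy, hGb]
  simp only [norm_mul, Complex.norm_real] at hnn hmono ⊢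
  rw [Real.norm_of_nonneg hnn, Real.norm_of_nonneg (hnn.trans hmono),
    mul_comm ‖φ y‖, mul_assoc]
  gcongr

theorem RobinConditions.form_eq {φ φ' : ℝ → ℝ} (hpos : ∀ x : ℝ, 0 ≤ x → 0 < φ x)
    (hL2 : MemLp φ 2 halfLine) (hφ : HasWeakDeriv φ φ') {γ : ℂ} (hγ : γ ≠ 0)
    {G : L2 →L[ℂ] L2} (hG : IsKernelOf (dirichletGreen φ) G)
    {g₁ g₁' w₁ w₁' g₂ g₂' w₂ w₂' : ℝ → ℂ}
    (h₁ : RobinConditions φ φ' γ g₁ g₁' w₁ w₁') (h₂ : RobinConditions φ φ' γ g₂ g₂' w₂ w₂')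
    {f u : L2} (hf : f =ᵐ[halfLine] fun x ↦ (φ x : ℂ)⁻¹ * (-w₁' x)) (hu : u =ᵐ[halfLine] g₂) :
    Integrable (fun x : ℝ ↦ ((φ x : ℂ) * g₁' x - (φ' x : ℂ) * g₁ x) *
      ((φ x : ℂ) * starRingEnd ℂ (g₂' x) - (φ' x : ℂ) * starRingEnd ℂ (g₂ x)) *
        ((φ x : ℂ) ^ 2)⁻¹) halfLine ∧
    inner ℂ u f = (∫ x in Ioi (0 : ℝ), ((φ x : ℂ) * g₁' x - (φ' x : ℂ) * g₁ x) *
      ((φ x : ℂ) * starRingEnd ℂ (g₂' x) - (φ' x : ℂ) * starRingEnd ℂ (g₂ x)) *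
        ((φ x : ℂ) ^ 2)⁻¹) + g₁ 0 * starRingEnd ℂ (g₂ 0) / (γ * (φ 0 : ℂ) ^ 2) := by
  obtain ⟨f₂, hf₂⟩ := h₂.exists_image
  have hpos0 {x : ℝ} (hx : 0 ≤ x) : (φ x : ℂ) ≠ 0 := Complex.ofReal_ne_zero.2 (hpos x hx).ne'
  have e₁ {x : ℝ} (hx : 0 ≤ x) := h₁.eq_robinQuotient hpos hL2 hφ hγ hf hx
  have e₂ {x : ℝ} (hx : 0 ≤ x) := h₂.eq_robinQuotient hpos hL2 hφ hγ hf₂ hx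
  obtain ⟨i1, i2, i3⟩ := integral_green_form hpos hφ.continuousOn hL2 hG f f₂
  set A₁ := tail fun y ↦ (φ y : ℂ) * f y
  set A₂ := tail fun y ↦ (φ y : ℂ) * f₂ y
  have hcongr : (fun s ↦ ((φ s : ℂ) ^ 2)⁻¹ * starRingEnd ℂ (A₂ s) * A₁ s) =ᵐ[halfLine]
      fun x ↦ ((φ x : ℂ) * g₁' x - (φ' x : ℂ) * g₁ x) *
      ((φ x : ℂ) * starRingEnd ℂ (g₂' x) - (φ' x : ℂ) * starRingEnd ℂ (g₂ x)) *
        ((φ x : ℂ) ^ 2)⁻¹ := by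
    filter_upwards [h₁.quasi_eq, h₂.quasi_eq, ae_restrict_mem measurableSet_Ioi] with x k1 k2 hx
    rw [← (e₁ (le_of_lt hx)).1, ← (e₂ (le_of_lt hx)).1, ← k1, k2]
    simp only [map_sub, map_mul, Complex.conj_ofReal]
    ring
  refine ⟨i1.congr hcongr, ?_⟩
  rw [← integral_congr_ae hcongr, i3, MeasureTheory.L2.inner_def]
  have hF := integrable_mul_L2 hL2 f
  -- Here `u = G_γ f₂` is split into its Dirichlet part, which Fubini has already evaluated, and the
  -- multiple `γ A₂(0) φ`.
  have hinner : (fun x ↦ inner ℂ (u x) (f x)) =ᵐ[halfLine] fun y ↦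
      (φ y : ℂ) * f y * starRingEnd ℂ (∫ s in (0 : ℝ)..y, ((φ s : ℂ) ^ 2)⁻¹ * A₂ s) +
        (φ y : ℂ) * f y * starRingEnd ℂ (γ * A₂ 0) := by
    filter_upwards [hu, ae_restrict_mem measurableSet_Ioi] with x k hx
    rw [RCLike.inner_apply, k, (e₂ (le_of_lt hx)).2, robinQuotient, map_mul, map_add,
      Complex.conj_ofReal]
    ring
  rw [integral_congr_ae hinner, integral_add i2 (hF.mul_const _), integral_mul_const]
  congr 1
  have hA : ∫ y, (φ y : ℂ) * f y ∂halfLine = A₁ 0 := rfl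
  have h0 := hpos0 le_rfl
  rw [hA, (e₁ le_rfl).2, (e₂ le_rfl).2]
  simp only [robinQuotient, intervalIntegral.integral_same, add_zero, map_mul,
    Complex.conj_ofReal]
  -- Since `gᵢ(0) = γ φ(0) Aᵢ(0)`, the rank-one term `A₁(0) conj(γ A₂(0))` equals `g₁(0) conj(g₂(0))
  -- / (γ φ(0)²)`.
  change _ = (φ 0 : ℂ) * (γ * A₁ 0) * ((φ 0 : ℂ) * (starRingEnd ℂ γ * starRingEnd ℂ (A₂ 0))) / _
  field_simp

end RobinSchrodinger

end

theorem theorem5p2 (φ φ' : ℝ → ℝ)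
    (hpos : ∀ x : ℝ, 0 ≤ x → 0 < φ x)
    (hL2 : MemLp φ 2 RobinSchrodinger.halfLine)
    (hφ : RobinSchrodinger.HasWeakDeriv φ φ')
    (hG : ∃ G : RobinSchrodinger.L2 →L[ℂ] RobinSchrodinger.L2,
      RobinSchrodinger.IsKernelOf (RobinSchrodinger.dirichletGreen φ) G)
    (γ : ℂ) (hγ : γ ≠ 0) :
    ∃ Gγ : RobinSchrodinger.L2 →L[ℂ] RobinSchrodinger.L2,
      -- `G_γ` is the bounded operator with kernel `G_γ(x,y)`, and it is invertible on its range
      RobinSchrodinger.IsKernelOf (RobinSchrodinger.robinGreen φ γ) Gγ ∧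
      Function.Injective Gγ ∧
      -- `Dom(H_γ) = Ran(G_γ) = 𝒟_γ`, where `H_γ = G_γ⁻¹`
      ((RobinSchrodinger.inverseOp Gγ).domain : Set RobinSchrodinger.L2) = Set.range Gγ ∧
      Set.range Gγ = RobinSchrodinger.robinDomain φ φ' γ ∧
      -- `H_γ g = φ⁻¹ (φ' g - φ g')'`
      (∀ (u : (RobinSchrodinger.inverseOp Gγ).domain) (g g' w w' : ℝ → ℂ),
        (u : RobinSchrodinger.L2) =ᵐ[RobinSchrodinger.halfLine] g →
        RobinSchrodinger.RobinConditions φ φ' γ g g' w w' →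
        RobinSchrodinger.inverseOp Gγ u
          =ᵐ[RobinSchrodinger.halfLine] fun x => (φ x : ℂ)⁻¹ * (-w' x)) ∧
      -- the quadratic form; `⟨H_γ g₁, g₂⟩` is linear in the first variable, so that it is
      -- `inner ℂ g₂ (H_γ g₁)` in the convention of Mathlib
      (∀ (u₁ u₂ : (RobinSchrodinger.inverseOp Gγ).domain)
        (g₁ g₁' w₁ w₁' g₂ g₂' w₂ w₂' : ℝ → ℂ),
        (u₁ : RobinSchrodinger.L2) =ᵐ[RobinSchrodinger.halfLine] g₁ →
        RobinSchrodinger.RobinConditions φ φ' γ g₁ g₁' w₁ w₁' →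
        (u₂ : RobinSchrodinger.L2) =ᵐ[RobinSchrodinger.halfLine] g₂ →
        RobinSchrodinger.RobinConditions φ φ' γ g₂ g₂' w₂ w₂' →
        Integrable (fun x : ℝ =>
          ((φ x : ℂ) * g₁' x - (φ' x : ℂ) * g₁ x) *
            ((φ x : ℂ) * starRingEnd ℂ (g₂' x) - (φ' x : ℂ) * starRingEnd ℂ (g₂ x)) *
            ((φ x : ℂ) ^ 2)⁻¹) RobinSchrodinger.halfLine ∧
        inner ℂ (u₂ : RobinSchrodinger.L2) (RobinSchrodinger.inverseOp Gγ u₁) =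
          (∫ x in Set.Ioi (0 : ℝ), ((φ x : ℂ) * g₁' x - (φ' x : ℂ) * g₁ x) *
            ((φ x : ℂ) * starRingEnd ℂ (g₂' x) - (φ' x : ℂ) * starRingEnd ℂ (g₂ x)) *
            ((φ x : ℂ) ^ 2)⁻¹) +
          g₁ 0 * starRingEnd ℂ (g₂ 0) / (γ * (φ 0 : ℂ) ^ 2)) := by
  obtain ⟨G, hG⟩ := hG
  have hinj := RobinSchrodinger.injective_robinOperator hpos hL2 hφ hγ hG
  have happ (u : (RobinSchrodinger.inverseOp
      (RobinSchrodinger.robinOperator hL2 γ G)).domain) (g g' w w' : ℝ → ℂ)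
      (hu : (u : RobinSchrodinger.L2) =ᵐ[RobinSchrodinger.halfLine] g)
      (h : RobinSchrodinger.RobinConditions φ φ' γ g g' w w') :
      RobinSchrodinger.inverseOp (RobinSchrodinger.robinOperator hL2 γ G) u
        =ᵐ[RobinSchrodinger.halfLine] fun x => (φ x : ℂ)⁻¹ * (-w' x) := by
    obtain ⟨f, hf⟩ := h.exists_image
    rwa [RobinSchrodinger.inverseOp_apply_eq hinj u
      (h.robinOperator_eq hpos hL2 hφ hγ hG hf hu)]
  refine ⟨RobinSchrodinger.robinOperator hL2 γ G,
    RobinSchrodinger.isKernelOf_robinOperator hL2 γ hG, hinj,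
    RobinSchrodinger.inverseOp_domain _,
    RobinSchrodinger.range_robinOperator hpos hL2 hφ hγ hG, happ, ?_⟩
  intro u₁ u₂ g₁ g₁' w₁ w₁' g₂ g₂' w₂ w₂' hu₁ h₁ hu₂ h₂
  exact h₁.form_eq hpos hL2 hφ hγ hG h₂ (happ u₁ g₁ g₁' w₁ w₁' hu₁ h₁) hu₂
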